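/- Let $K$ be a field of characteristic zero, $n\ge 0$, $R=K[X_1,\dots,X_n]$, and let $A_n(K)=K\langle X_1,\dots,X_n,\partial_1,\dots,\partial_n\rangle$ be the $n$-th Weyl algebra, $\mathbb Z$-graded by $\deg X_i=1$, $\deg\partial_i=-1$. Put $\mathcal E_n=\sum_{i=1}^n X_i\partial_i$. A graded left $A_n(K)$-module $W=\bigoplus_{d\in\mathbb Z}W_d$ is called strongly generalized Eulerian if there is an integer $a>0$ such that $(\mathcal E_n-d)^a w=0$ for all $d\in\mathbb Z$ and all $w\in W_d$. For graded left $A_n(K)$-modules $M,N$ let ${}^*\mathrm{Hom}_R(M,N)=\bigoplus_{d\in\mathbb Z}\mathrm{Hom}_d(M,N)$, where $\mathrm{Hom}_d(M,N)$ is the group of $R$-linear maps $\varphi:M\to N$ with $\varphi(M_e)\subseteq N_{e+d}$ for all $e$. It is a graded left $A_n(K)$-module via $(X_i\varphi)(m)=X_i\varphi(m)$ and $(\partial_i\varphi)(m)=\partial_i\varphi(m)-\varphi(\partial_i m)$. For $i\ge 0$ let ${}^*\mathrm{Ext}^i_R(M,N)=H^i({}^*\mathrm{Hom}_R(M,\mathbb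 I^\bullet))$, a graded left $A_n(K)$-module, where $0\to N\to \mathbb I^0\to \mathbb I^1\to\cdots$ is a resolution of $N$ by injective objects of the category of graded left $A_n(K)$-modules (these are also injective as graded $R$-modules). Theorem. If $M$ and $N$ are strongly generalized Eulerian graded left $A_n(K)$-modules, then ${}^*\mathrm{Ext}^i_R(M,N)$ (computed from any such resolution of $N$) is a strongly generalized Eulerian graded $A_n(K)$-module for all $i\ge 0$. -/

import Mathlib

universe u v w

noncomputable section

/-! ### The Weyl algebra with its grading -/

/-- The defining relations of the Weyl algebra, on the free algebra with generators
`x_i = ι (Sum.inl i)` and `∂_i = ι (Sum.inr i)`. -/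
inductive WeylAlgebra.Rel (K : Type u) [Field K] (n : ℕ) :
    FreeAlgebra K (Fin n ⊕ Fin n) → FreeAlgebra K (Fin n ⊕ Fin n) → Prop
  | X_comm (i j : Fin n) : WeylAlgebra.Rel K n
      (FreeAlgebra.ι K (Sum.inl i) * FreeAlgebra.ι K (Sum.inl j))
      (FreeAlgebra.ι K (Sum.inl j) * FreeAlgebra.ι K (Sum.inl i))
  | D_comm (i j : Fin n) : WeylAlgebra.Rel K n
      (FreeAlgebra.ι K (Sum.inr i) * FreeAlgebra.ι K (Sum.inr j))
      (FreeAlgebra.ι K (Sum.inr j) * FreeAlgebra.ι K (Sum.inr i))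
  | D_X (i j : Fin n) : WeylAlgebra.Rel K n
      (FreeAlgebra.ι K (Sum.inr i) * FreeAlgebra.ι K (Sum.inl j))
      (FreeAlgebra.ι K (Sum.inl j) * FreeAlgebra.ι K (Sum.inr i) + if i = j then 1 else 0)

/-- The `n`-th Weyl algebra `A_n(K) = K⟨X_1, …, X_n, ∂_1, …, ∂_n⟩`. -/
def WeylAlgebra (K : Type u) [Field K] (n : ℕ) : Type u :=
  RingQuot (WeylAlgebra.Rel K n)

namespace WeylAlgebra

section

variable {K : Type u} [Field K] {n : ℕ}

instance : Ring (WeylAlgebra K n) := inferInstanceAs (Ring (RingQuot (WeylAlgebra.Rel K n)))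

instance : Algebra K (WeylAlgebra K n) :=
  inferInstanceAs (Algebra K (RingQuot (WeylAlgebra.Rel K n)))

variable (K n) in
/-- The quotient map from the free algebra. -/
def mk : FreeAlgebra K (Fin n ⊕ Fin n) →ₐ[K] WeylAlgebra K n :=
  RingQuot.mkAlgHom K (WeylAlgebra.Rel K n)

/-- The two families of generators, indexed together. -/
def gen (s : Fin n ⊕ Fin n) : WeylAlgebra K n := mk K n (FreeAlgebra.ι K s)

/-- The generator `X_i`. -/
def X (i : Fin n) : WeylAlgebra K n := gen (Sum.inl i)

/-- The generator `∂_i`. -/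
def D (i : Fin n) : WeylAlgebra K n := gen (Sum.inr i)

variable (K n) in
/-- The Eulerian operator `∑ i, X_i ∂_i`. -/
def euler : WeylAlgebra K n := ∑ i, X i * D i

theorem X_mul_X (i j : Fin n) : (X i * X j : WeylAlgebra K n) = X j * X i := by
  have := RingQuot.mkAlgHom_rel K (Rel.X_comm (K := K) i j)
  rwa [map_mul, map_mul] at this

theorem D_mul_D (i j : Fin n) : (D i * D j : WeylAlgebra K n) = D j * D i := by
  have := RingQuot.mkAlgHom_rel K (Rel.D_comm (K := K) i j)
  rwa [map_mul, map_mul] at this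

theorem D_mul_X (i j : Fin n) :
    (D i * X j : WeylAlgebra K n) = X j * D i + if i = j then 1 else 0 := by
  have := RingQuot.mkAlgHom_rel K (Rel.D_X (K := K) i j)
  rw [map_mul, map_add, map_mul] at this
  refine this.trans ?_
  congr 1
  split_ifs
  · exact map_one (RingQuot.mkAlgHom K (WeylAlgebra.Rel K n))
  · exact map_zero (RingQuot.mkAlgHom K (WeylAlgebra.Rel K n))

/-- The universal property of the Weyl algebra. -/
def lift {B : Type v} [Ring B] [Algebra K B] (x d : Fin n → B)
    (hx : ∀ i j, x i * x j = x j * x i) (hd : ∀ i j, d i * d j = d j * d i)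
    (hdx : ∀ i j, d i * x j = x j * d i + if i = j then 1 else 0) : WeylAlgebra K n →ₐ[K] B :=
  RingQuot.liftAlgHom K ⟨FreeAlgebra.lift K (Sum.elim x d), by
    intro a b h
    cases h with
    | X_comm i j => simpa using hx i j
    | D_comm i j => simpa using hd i j
    | D_X i j =>
      have := hdx i j
      split_ifs at this ⊢ with hij <;> simpa using this⟩

theorem lift_gen {B : Type v} [Ring B] [Algebra K B] (x d : Fin n → B) (hx hd hdx)
    (s : Fin n ⊕ Fin n) : lift (K := K) x d hx hd hdx (gen s) = Sum.elim x d s := by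
  unfold lift gen mk
  erw [RingQuot.liftAlgHom_mkAlgHom_apply]
  simp

theorem lift_X {B : Type v} [Ring B] [Algebra K B] (x d : Fin n → B) (hx hd hdx)
    (i : Fin n) : lift (K := K) x d hx hd hdx (X i) = x i := lift_gen x d hx hd hdx _

theorem lift_D {B : Type v} [Ring B] [Algebra K B] (x d : Fin n → B) (hx hd hdx)
    (i : Fin n) : lift (K := K) x d hx hd hdx (D i) = d i := lift_gen x d hx hd hdx _

theorem hom_ext {B : Type v} [Ring B] [Algebra K B] {f g : WeylAlgebra K n →ₐ[K] B}
    (hX : ∀ i, f (X i) = g (X i)) (hD : ∀ i, f (D i) = g (D i)) : f = g := by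
  refine RingQuot.ringQuot_ext' K f g (FreeAlgebra.hom_ext ?_)
  funext s
  rcases s with i | i
  · exact hX i
  · exact hD i

/-- The degrees of the generators: `deg X_i = 1` and `deg ∂_i = -1`. -/
def genDeg : Fin n ⊕ Fin n → ℤ := Sum.elim (fun _ => 1) (fun _ => -1)

variable (K n) in
/-- The homogeneous component of degree `d`: the span of all products of generators whose
degrees add up to `d`. -/
def grading (d : ℤ) : Submodule K (WeylAlgebra K n) :=
  Submodule.span K {a | ∃ l : List (Fin n ⊕ Fin n), (l.map genDeg).sum = d ∧ a = (l.map gen).prod}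

theorem prod_mem_grading (l : List (Fin n ⊕ Fin n)) :
    (l.map gen).prod ∈ grading K n (l.map genDeg).sum :=
  Submodule.subset_span ⟨l, rfl, rfl⟩

theorem gen_mem_grading (s : Fin n ⊕ Fin n) : gen s ∈ grading K n (genDeg s) := by
  simpa using prod_mem_grading (K := K) [s]

theorem X_mem_grading (i : Fin n) : X i ∈ grading K n 1 := gen_mem_grading (Sum.inl i)

theorem D_mem_grading (i : Fin n) : D i ∈ grading K n (-1) := gen_mem_grading (Sum.inr i)

instance : SetLike.GradedMonoid (grading K n) where
  one_mem := by simpa using prod_mem_grading (K := K) (n := n) []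
  mul_mem := by
    intro d e a b ha hb
    induction ha using Submodule.span_induction with
    | zero => simp
    | add x y _ _ hx hy => rw [add_mul]; exact add_mem hx hy
    | smul c x _ hx => rw [smul_mul_assoc]; exact Submodule.smul_mem _ _ hx
    | mem x hx =>
      obtain ⟨l, rfl, rfl⟩ := hx
      induction hb using Submodule.span_induction with
      | zero => simp
      | add x y _ _ hx hy => rw [mul_add]; exact add_mem hx hy
      | smul c x _ hx => rw [mul_smul_comm]; exact Submodule.smul_mem _ _ hx
      | mem x hx =>
        obtain ⟨l', rfl, rfl⟩ := hx
        simpa using prod_mem_grading (K := K) (l ++ l')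

variable (K n) in
/-- The decomposition of an element into its homogeneous components. -/
def decomposeHom : WeylAlgebra K n →ₐ[K] DirectSum ℤ (fun d => grading K n d) :=
  lift (fun i => DirectSum.of (fun d => grading K n d) 1 ⟨X i, X_mem_grading i⟩)
    (fun i => DirectSum.of (fun d => grading K n d) (-1) ⟨D i, D_mem_grading i⟩)
    (fun i j => by
      rw [DirectSum.of_mul_of, DirectSum.of_mul_of]
      congr 1
      exact Subtype.ext (X_mul_X i j))
    (fun i j => by
      rw [DirectSum.of_mul_of, DirectSum.of_mul_of]
      congr 1
      exact Subtype.ext (D_mul_D i j))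
    (fun i j => by
      have h0 : (if i = j then 1 else 0 : DirectSum ℤ (fun d => grading K n d)) =
          DirectSum.of (fun d => grading K n d) (1 + -1)
            ⟨if i = j then 1 else 0, by
              split_ifs
              · exact SetLike.GradedOne.one_mem (A := grading K n)
              · exact zero_mem _⟩ := by
        split_ifs
        · rfl
        · exact (map_zero (DirectSum.of (fun d => grading K n d) (1 + -1))).symm
      rw [DirectSum.of_mul_of, DirectSum.of_mul_of, h0, ← map_add]
      refine DirectSum.of_eq_of_gradedMonoid_eq (Sigma.subtype_ext ?_ ?_)
      · rfl
      · exact D_mul_X i j)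

theorem decomposeHom_gen (s : Fin n ⊕ Fin n) : decomposeHom K n (gen s) =
    DirectSum.of (fun d => grading K n d) (genDeg s) ⟨gen s, gen_mem_grading s⟩ := by
  rw [decomposeHom, lift_gen]
  rcases s with i | i <;> rfl

theorem decomposeHom_prod (l : List (Fin n ⊕ Fin n)) : decomposeHom K n (l.map gen).prod =
    DirectSum.of (fun d => grading K n d) (l.map genDeg).sum
      ⟨(l.map gen).prod, prod_mem_grading l⟩ := by
  induction l with
  | nil => exact map_one _
  | cons s l ih =>
    simp only [List.map_cons, List.prod_cons, map_mul, ih, decomposeHom_gen, DirectSum.of_mul_of]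
    rfl

/-- The Weyl algebra is a `ℤ`-graded algebra. -/
instance : GradedAlgebra (grading K n) :=
  GradedAlgebra.ofAlgHom (grading K n) (decomposeHom K n)
    (by
      refine hom_ext (fun i => ?_) (fun i => ?_)
      · simp only [AlgHom.comp_apply, X, decomposeHom_gen, DirectSum.coeAlgHom_of, AlgHom.id_apply]
      · simp only [AlgHom.comp_apply, D, decomposeHom_gen, DirectSum.coeAlgHom_of, AlgHom.id_apply])
    (by
      rintro d ⟨a, ha⟩
      induction ha using Submodule.span_induction with
      | zero => exact (map_zero _).trans (map_zero (DirectSum.of (fun d => grading K n d) d)).symm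
      | add x y hx hy hx' hy' =>
        dsimp only at hx' hy' ⊢
        rw [map_add, hx', hy', ← map_add]
        rfl
      | smul c x hx hx' =>
        dsimp only at hx' ⊢
        rw [map_smul, hx', ← DirectSum.lof_eq_of K, ← map_smul]
        rfl
      | mem x hx =>
        obtain ⟨l, rfl, rfl⟩ := hx
        exact decomposeHom_prod l)

end

end WeylAlgebra

/-! ### Graded modules over the Weyl algebra -/

/-- A graded left `A_n(K)`-module: a left `A_n(K)`-module `M` with a decomposition
`M = ⨁ M_d`, `d ∈ ℤ`, into additive subgroups (automatically `K`-subspaces) such that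
`A_n(K)_d M_e ⊆ M_{d+e}`. -/
structure GradedWeylModule (K : Type u) [Field K] (n : ℕ) : Type (max u (v + 1)) where
  carrier : Type v
  [addCommGroup : AddCommGroup carrier]
  [moduleField : Module K carrier]
  [module : Module (WeylAlgebra K n) carrier]
  [isScalarTower : IsScalarTower K (WeylAlgebra K n) carrier]
  grading : ℤ → Submodule K carrier
  isInternal : DirectSum.IsInternal grading
  gradedSMul : SetLike.GradedSMul (WeylAlgebra.grading K n) grading

namespace GradedWeylModule

attribute [instance] addCommGroup moduleField module isScalarTower gradedSMul

instance (K : Type u) [Field K] (n : ℕ) :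
    CoeSort (GradedWeylModule.{u, v} K n) (Type v) := ⟨carrier⟩

/-- `M` is strongly generalized Eulerian: there is one `a > 0` with
`(∑ X_i ∂_i - |w|)^a w = 0` for all homogeneous `w`. -/
def IsStronglyGeneralizedEulerian {K : Type u} [Field K] {n : ℕ}
    (M : GradedWeylModule.{u, v} K n) : Prop :=
  ∃ a : ℕ, 0 < a ∧ ∀ (d : ℤ) (m : M), m ∈ M.grading d →
    (WeylAlgebra.euler K n - (d : WeylAlgebra K n)) ^ a • m = 0

/-- Morphisms of graded modules: `A_n(K)`-linear maps of degree `0`. -/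
structure Hom {K : Type u} [Field K] {n : ℕ} (M : GradedWeylModule.{u, v} K n)
    (N : GradedWeylModule.{u, w} K n) where
  toLinearMap : M →ₗ[WeylAlgebra K n] N
  map_mem : ∀ (d : ℤ) (m : M), m ∈ M.grading d → toLinearMap m ∈ N.grading d

section

variable {K : Type u} [Field K] {n : ℕ}

instance (M : GradedWeylModule.{u, v} K n) (N : GradedWeylModule.{u, w} K n) :
    CoeFun (Hom M N) (fun _ => M → N) := ⟨fun f => f.toLinearMap⟩

/-- The zero morphism. -/
def Hom.zero (M : GradedWeylModule.{u, v} K n) (N : GradedWeylModule.{u, w} K n) : Hom M N where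
  toLinearMap := 0
  map_mem _ _ _ := zero_mem _

/-! ### Tools for constructing graded modules -/

theorem gradedSMul_of_gen {W : Type v} [AddCommGroup W] [Module K W] [Module (WeylAlgebra K n) W]
    [IsScalarTower K (WeylAlgebra K n) W] (G : ℤ → Submodule K W)
    (hX : ∀ (i : Fin n) (d e : ℤ) (w : W), w ∈ G d → d + 1 = e →
      (WeylAlgebra.X i : WeylAlgebra K n) • w ∈ G e)
    (hD : ∀ (i : Fin n) (d e : ℤ) (w : W), w ∈ G d → d - 1 = e →
      (WeylAlgebra.D i : WeylAlgebra K n) • w ∈ G e) :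
    SetLike.GradedSMul (WeylAlgebra.grading K n) G where
  smul_mem := by
    intro d e a w ha hw
    rw [vadd_eq_add]
    induction ha using Submodule.span_induction with
    | zero => simp
    | add x y _ _ hx hy => rw [add_smul]; exact add_mem hx hy
    | smul c x _ hx => rw [smul_assoc]; exact Submodule.smul_mem _ _ hx
    | mem x hx =>
      obtain ⟨l, rfl, rfl⟩ := hx
      induction l with
      | nil => simpa using hw
      | cons s l ih =>
        rw [List.map_cons, List.map_cons, List.prod_cons, List.sum_cons, mul_smul]
        rcases s with i | i
        · exact hX i _ _ _ ih (by simp [WeylAlgebra.genDeg]; ring)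
        · exact hD i _ _ _ ih (by simp [WeylAlgebra.genDeg]; ring)

theorem isInternal_of_separating {W : Type v} [AddCommGroup W] [Module K W]
    (G : ℤ → Submodule K W) (hspan : ∀ w, w ∈ ⨆ d, G d)
    (hsep : ∀ (d : ℤ) (w : W), w ∈ G d → w ≠ 0 → ∃ (V : Type w) (_ : AddCommGroup V)
      (_ : Module K V) (p : W →ₗ[K] V), (∀ e, e ≠ d → ∀ x ∈ G e, p x = 0) ∧ p w ≠ 0) :
    DirectSum.IsInternal G := by
  refine DirectSum.isInternal_submodule_of_iSupIndep_of_iSup_eq_top ?_ ?_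
  · intro d
    rw [Submodule.disjoint_def]
    intro w hw hw'
    by_contra h0
    obtain ⟨V, _, _, p, hp, hpw⟩ := hsep d w hw h0
    refine hpw ?_
    have : (⨆ j, ⨆ (_ : j ≠ d), G j) ≤ LinearMap.ker p :=
      iSup_le fun e => iSup_le fun he x hx => hp e he x hx
    exact this hw'
  · exact eq_top_iff.mpr fun w _ => hspan w

variable (M : GradedWeylModule.{u, v} K n)

theorem X_smul_mem (i : Fin n) {d e : ℤ} {m : M} (hm : m ∈ M.grading d) (h : d + 1 = e) :
    (WeylAlgebra.X i : WeylAlgebra K n) • m ∈ M.grading e := by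
  have := M.gradedSMul.smul_mem (WeylAlgebra.X_mem_grading i) hm
  rwa [vadd_eq_add, show (1 : ℤ) + d = e by omega] at this

theorem D_smul_mem (i : Fin n) {d e : ℤ} {m : M} (hm : m ∈ M.grading d) (h : d - 1 = e) :
    (WeylAlgebra.D i : WeylAlgebra K n) • m ∈ M.grading e := by
  have := M.gradedSMul.smul_mem (WeylAlgebra.D_mem_grading i) hm
  rwa [vadd_eq_add, show (-1 : ℤ) + d = e by omega] at this

theorem mem_iSup_grading (m : M) : m ∈ ⨆ d, M.grading d := by
  rw [M.isInternal.submodule_iSup_eq_top]; trivial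

/-- Two linear maps that agree on homogeneous elements are equal. -/
theorem linearMap_ext {W : Type w} [AddCommGroup W] [Module K W] {f g : M →ₗ[K] W}
    (h : ∀ d, ∀ m ∈ M.grading d, f m = g m) : f = g := by
  ext m
  have : (⨆ d, M.grading d) ≤ LinearMap.eqLocus f g := iSup_le fun d m hm => h d m hm
  exact this (M.mem_iSup_grading m)

/-- The projection of a graded module to its component of degree `d`. -/
def proj (d : ℤ) : M →ₗ[K] M :=
  (M.grading d).subtype ∘ₗ DirectSum.component K ℤ (fun d => M.grading d) d ∘ₗ
    (LinearEquiv.ofBijective (DirectSum.coeLinearMap M.grading) M.isInternal).symm.toLinearMap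

theorem proj_mem (d : ℤ) (m : M) : M.proj d m ∈ M.grading d := Subtype.property _

theorem proj_of_mem {d : ℤ} {m : M} (hm : m ∈ M.grading d) : M.proj d m = m :=
  congrArg Subtype.val (M.isInternal.ofBijective_coeLinearMap_of_mem hm)

theorem proj_of_mem_ne {d e : ℤ} {m : M} (hm : m ∈ M.grading d) (h : d ≠ e) :
    M.proj e m = 0 :=
  congrArg Subtype.val (M.isInternal.ofBijective_coeLinearMap_of_mem_ne h hm)

/-- Every element lies in the span of its homogeneous components. -/
theorem mem_of_proj_mem (S : Submodule K M) (m : M) (h : ∀ d, M.proj d m ∈ S) : m ∈ S := by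
  set x := (LinearEquiv.ofBijective (DirectSum.coeLinearMap M.grading) M.isInternal).symm m with hx
  classical
  have hm : m = DirectSum.coeLinearMap M.grading x := by
    rw [hx]
    exact ((LinearEquiv.ofBijective (DirectSum.coeLinearMap M.grading)
      M.isInternal).apply_symm_apply m).symm
  rw [hm, DirectSum.coeLinearMap_eq_dfinsuppSum]
  exact Submodule.dfinsuppSum_mem _ _ _ fun d _ => h d

variable {M}

theorem Hom.map_proj {N : GradedWeylModule.{u, w} K n} (f : Hom M N) (d : ℤ) (m : M) :
    f (M.proj d m) = N.proj d (f m) := by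
  have : (f.toLinearMap.restrictScalars K) ∘ₗ M.proj d =
      N.proj d ∘ₗ (f.toLinearMap.restrictScalars K) := by
    refine M.linearMap_ext fun e m hm => ?_
    simp only [LinearMap.comp_apply, LinearMap.restrictScalars_apply]
    by_cases h : e = d
    · subst h
      rw [proj_of_mem _ hm, proj_of_mem _ (f.map_mem _ _ hm)]
    · rw [proj_of_mem_ne _ hm h, proj_of_mem_ne _ (f.map_mem _ _ hm) h, map_zero]
  exact LinearMap.congr_fun this m

/-! ### Cohomology of a sequence of graded modules -/

/-- The part of degree `d` of `ker g / (ker g ∩ im f)`. -/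
def cohomologyGrading {U V W : GradedWeylModule.{u, v} K n} (f : Hom U V) (g : Hom V W) (d : ℤ) :
    Submodule K (LinearMap.ker g.toLinearMap ⧸
      (LinearMap.range f.toLinearMap).comap (LinearMap.ker g.toLinearMap).subtype) :=
  ((V.grading d).comap ((LinearMap.ker g.toLinearMap).subtype.restrictScalars K)).map
    (((LinearMap.range f.toLinearMap).comap
      (LinearMap.ker g.toLinearMap).subtype).mkQ.restrictScalars K)

/-- The cohomology at `V` of a complex `U → V → W` of graded `A_n(K)`-modules, as a graded
`A_n(K)`-module: the quotient of `ker g` by `im f` (intersected with `ker g`, which changes nothing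
for a complex), a class being of degree `d` when it is represented by a cocycle of degree `d`. -/
def cohomology {U V W : GradedWeylModule.{u, v} K n} (f : Hom U V) (g : Hom V W) :
    GradedWeylModule.{u, v} K n where
  carrier := LinearMap.ker g.toLinearMap ⧸
    (LinearMap.range f.toLinearMap).comap (LinearMap.ker g.toLinearMap).subtype
  grading := cohomologyGrading f g
  isInternal := by
    refine isInternal_of_separating _ ?_ ?_
    · intro w
      obtain ⟨⟨z, hz⟩, rfl⟩ := Submodule.mkQ_surjective _ w
      have hz' : z ∈ (((⨆ d, cohomologyGrading f g d).comap
          (((LinearMap.range f.toLinearMap).comap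
            (LinearMap.ker g.toLinearMap).subtype).mkQ.restrictScalars K)).map
          ((LinearMap.ker g.toLinearMap).subtype.restrictScalars K)) := by
        refine V.mem_of_proj_mem _ z fun d => ?_
        have hk : V.proj d z ∈ LinearMap.ker g.toLinearMap := by
          rw [LinearMap.mem_ker] at hz ⊢
          rw [Hom.map_proj, hz, map_zero]
        refine ⟨⟨V.proj d z, hk⟩, ?_, rfl⟩
        exact Submodule.mem_iSup_of_mem d ⟨⟨V.proj d z, hk⟩, V.proj_mem d z, rfl⟩
      obtain ⟨⟨y, hy⟩, hy', hyz⟩ := hz'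
      obtain rfl : y = z := hyz
      exact hy'
    · rintro d _ ⟨⟨z, hz⟩, hzd, rfl⟩ h0
      let r : Submodule K V := (LinearMap.range f.toLinearMap).restrictScalars K
      have hp : V.proj d z = z := proj_of_mem _ hzd
      let q : (LinearMap.ker g.toLinearMap ⧸ (LinearMap.range f.toLinearMap).comap
          (LinearMap.ker g.toLinearMap).subtype) →ₗ[WeylAlgebra K n]
          (V ⧸ LinearMap.range f.toLinearMap) :=
        Submodule.mapQ _ _ (LinearMap.ker g.toLinearMap).subtype le_rfl
      have hpr : r ≤ r.comap (V.proj d) := by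
        rintro _ ⟨y, rfl⟩
        exact ⟨U.proj d y, Hom.map_proj f d y⟩
      refine ⟨V ⧸ r, inferInstance, inferInstance,
        (Submodule.mapQ r r (V.proj d) hpr) ∘ₗ (q.restrictScalars K), ?_, ?_⟩
      · rintro e he _ ⟨⟨y, hy⟩, hye, rfl⟩
        have hp : V.proj d y = 0 := proj_of_mem_ne _ hye he
        change Submodule.mapQ r r (V.proj d) hpr (r.mkQ y) = 0
        rw [Submodule.mkQ_apply, Submodule.mapQ_apply, hp, Submodule.Quotient.mk_zero]
      · change Submodule.mapQ r r (V.proj d) hpr (r.mkQ z) ≠ 0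
        rw [Submodule.mkQ_apply, Submodule.mapQ_apply, hp]
        intro h
        rw [Submodule.Quotient.mk_eq_zero] at h
        have h' : (⟨z, hz⟩ : LinearMap.ker g.toLinearMap) ∈ (LinearMap.range f.toLinearMap).comap
          (LinearMap.ker g.toLinearMap).subtype := h
        exact h0 ((Submodule.Quotient.mk_eq_zero _).mpr h')
  gradedSMul := by
    refine gradedSMul_of_gen _ ?_ ?_
    · rintro i d e _ ⟨z, hz, rfl⟩ h
      exact ⟨(WeylAlgebra.X i : WeylAlgebra K n) • z, V.X_smul_mem i hz h, rfl⟩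
    · rintro i d e _ ⟨z, hz, rfl⟩ h
      exact ⟨(WeylAlgebra.D i : WeylAlgebra K n) • z, V.D_smul_mem i hz h, rfl⟩

/-! ### The graded Hom module over the polynomial ring -/

/-- Multiplication by an element of `A_n(K)`, as a `K`-linear map. -/
def actionMap (M : GradedWeylModule.{u, v} K n) : WeylAlgebra K n →ₐ[K] Module.End K M :=
  Algebra.lsmul K K M

/-- `Hom_d(M, N)`: the `R`-linear maps `M → N` that are homogeneous of degree `d`. Here
`R = K[X_1, …, X_n]`, so that `R`-linear means `K`-linear and commuting with every `X_i`. -/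
def homDeg (M : GradedWeylModule.{u, v} K n) (N : GradedWeylModule.{u, w} K n) (d : ℤ) :
    Submodule K (M →ₗ[K] N) where
  carrier := {φ | (∀ (i : Fin n) (m : M), φ ((WeylAlgebra.X i : WeylAlgebra K n) • m) =
      (WeylAlgebra.X i : WeylAlgebra K n) • φ m) ∧
    ∀ (e : ℤ) (m : M), m ∈ M.grading e → φ m ∈ N.grading (e + d)}
  zero_mem' := ⟨by simp, by simp⟩
  add_mem' := by
    rintro φ ψ ⟨h1, h2⟩ ⟨h3, h4⟩
    exact ⟨fun i m => by simp [h1, h3], fun e m hm => add_mem (h2 e m hm) (h4 e m hm)⟩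
  smul_mem' := by
    rintro c φ ⟨h1, h2⟩
    exact ⟨fun i m => by
    rw [LinearMap.smul_apply, LinearMap.smul_apply, h1, smul_algebra_smul_comm], fun e m hm => Submodule.smul_mem _ _ (h2 e m hm)⟩

/-- `*Hom_R(M, N)`, the sum of all `Hom_d(M, N)`. -/
def starHomSubmodule (M : GradedWeylModule.{u, v} K n) (N : GradedWeylModule.{u, w} K n) :
    Submodule K (M →ₗ[K] N) := ⨆ d, homDeg M N d

/-- The action of `X_i` on maps: `(X_i φ)(m) = X_i φ(m)`. -/
def homX (M : GradedWeylModule.{u, v} K n) (N : GradedWeylModule.{u, w} K n) (i : Fin n) :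
    Module.End K (M →ₗ[K] N) where
  toFun φ := actionMap N (WeylAlgebra.X i) ∘ₗ φ
  map_add' φ ψ := by ext; simp
  map_smul' c φ := by ext; simp

/-- The action of `∂_i` on maps: `(∂_i φ)(m) = ∂_i φ(m) - φ(∂_i m)`. -/
def homD (M : GradedWeylModule.{u, v} K n) (N : GradedWeylModule.{u, w} K n) (i : Fin n) :
    Module.End K (M →ₗ[K] N) where
  toFun φ := actionMap N (WeylAlgebra.D i) ∘ₗ φ - φ ∘ₗ actionMap M (WeylAlgebra.D i)
  map_add' φ ψ := by ext; simp; abel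
  map_smul' c φ := by ext; simp [smul_sub]

theorem homX_apply (M : GradedWeylModule.{u, v} K n) (N : GradedWeylModule.{u, w} K n) (i : Fin n)
    (φ : M →ₗ[K] N) (m : M) : homX M N i φ m = (WeylAlgebra.X i : WeylAlgebra K n) • φ m := rfl

theorem homD_apply (M : GradedWeylModule.{u, v} K n) (N : GradedWeylModule.{u, w} K n) (i : Fin n)
    (φ : M →ₗ[K] N) (m : M) : homD M N i φ m =
      (WeylAlgebra.D i : WeylAlgebra K n) • φ m - φ ((WeylAlgebra.D i : WeylAlgebra K n) • m) := rfl

theorem homX_mem (M : GradedWeylModule.{u, v} K n) (N : GradedWeylModule.{u, w} K n) (i : Fin n)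
    {d e : ℤ} {φ : M →ₗ[K] N} (hφ : φ ∈ homDeg M N d) (h : d + 1 = e) :
    homX M N i φ ∈ homDeg M N e := by
  refine ⟨fun j m => ?_, fun k m hm => N.X_smul_mem i (hφ.2 k m hm) (by omega)⟩
  rw [homX_apply, homX_apply, hφ.1, ← mul_smul, ← mul_smul, WeylAlgebra.X_mul_X]

theorem homD_mem (M : GradedWeylModule.{u, v} K n) (N : GradedWeylModule.{u, w} K n) (i : Fin n)
    {d e : ℤ} {φ : M →ₗ[K] N} (hφ : φ ∈ homDeg M N d) (h : d - 1 = e) :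
    homD M N i φ ∈ homDeg M N e := by
  refine ⟨fun j m => ?_, fun k m hm => ?_⟩
  · rw [homD_apply, homD_apply, hφ.1, ← mul_smul, ← mul_smul, WeylAlgebra.D_mul_X, add_smul,
      add_smul, map_add, mul_smul, mul_smul, hφ.1, smul_sub]
    split_ifs <;> simp
  · rw [homD_apply]
    refine sub_mem (N.D_smul_mem i (hφ.2 k m hm) (by omega)) ?_
    have := hφ.2 (k - 1) _ (M.D_smul_mem i hm rfl)
    rwa [show k - 1 + d = k + e by omega] at this

theorem homX_mem_starHom (M : GradedWeylModule.{u, v} K n) (N : GradedWeylModule.{u, w} K n)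
    (i : Fin n) : ∀ φ ∈ starHomSubmodule M N, homX M N i φ ∈ starHomSubmodule M N := by
  have : starHomSubmodule M N ≤ (starHomSubmodule M N).comap (homX M N i) :=
    iSup_le fun d φ hφ => Submodule.mem_iSup_of_mem (d + 1) (homX_mem M N i hφ rfl)
  exact this

theorem homD_mem_starHom (M : GradedWeylModule.{u, v} K n) (N : GradedWeylModule.{u, w} K n)
    (i : Fin n) : ∀ φ ∈ starHomSubmodule M N, homD M N i φ ∈ starHomSubmodule M N := by
  have : starHomSubmodule M N ≤ (starHomSubmodule M N).comap (homD M N i) :=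
    iSup_le fun d φ hφ => Submodule.mem_iSup_of_mem (d - 1) (homD_mem M N i hφ rfl)
  exact this

/-- The action of `A_n(K)` on `*Hom_R(M, N)` determined by `homX` and `homD`. -/
def starHomAction (M : GradedWeylModule.{u, v} K n) (N : GradedWeylModule.{u, w} K n) :
    WeylAlgebra K n →ₐ[K] Module.End K (starHomSubmodule M N) :=
  WeylAlgebra.lift (fun i => (homX M N i).restrict (homX_mem_starHom M N i))
    (fun i => (homD M N i).restrict (homD_mem_starHom M N i))
    (fun i j => by
      ext φ m
      simp only [Module.End.mul_apply, LinearMap.coe_restrict_apply, homX_apply, ← mul_smul,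
        WeylAlgebra.X_mul_X i j])
    (fun i j => by
      ext φ m
      simp only [Module.End.mul_apply, LinearMap.coe_restrict_apply, homD_apply, smul_sub,
        ← mul_smul, WeylAlgebra.D_mul_D i j]
      abel)
    (fun i j => by
      ext φ m
      have h : ((if i = j then 1 else 0 : Module.End K (starHomSubmodule M N)) φ : M →ₗ[K] N) m =
          (if i = j then 1 else 0 : WeylAlgebra K n) • (φ : M →ₗ[K] N) m := by
        split_ifs <;> simp
      simp only [Module.End.mul_apply, LinearMap.add_apply, Submodule.coe_add,
        LinearMap.coe_restrict_apply, homD_apply, homX_apply, smul_sub, h, ← mul_smul,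
        WeylAlgebra.D_mul_X i j, add_smul]
      abel)

instance starHomModule (M : GradedWeylModule.{u, v} K n) (N : GradedWeylModule.{u, w} K n) :
    Module (WeylAlgebra K n) (starHomSubmodule M N) :=
  Module.compHom (starHomSubmodule M N) (starHomAction M N).toRingHom

instance (M : GradedWeylModule.{u, v} K n) (N : GradedWeylModule.{u, w} K n) :
    IsScalarTower K (WeylAlgebra K n) (starHomSubmodule M N) :=
  ⟨fun c a φ => by
    change starHomAction M N (c • a) φ = c • starHomAction M N a φ
    rw [map_smul]
    rfl⟩

theorem starHom_X_smul {M : GradedWeylModule.{u, v} K n} {N : GradedWeylModule.{u, w} K n}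
    (i : Fin n) (φ : starHomSubmodule M N) :
    ((WeylAlgebra.X i : WeylAlgebra K n) • φ : starHomSubmodule M N) =
      ⟨homX M N i φ, homX_mem_starHom M N i _ φ.2⟩ := by
  change starHomAction M N (WeylAlgebra.X i) φ = _
  rw [starHomAction, WeylAlgebra.lift_X]
  rfl

theorem starHom_D_smul {M : GradedWeylModule.{u, v} K n} {N : GradedWeylModule.{u, w} K n}
    (i : Fin n) (φ : starHomSubmodule M N) :
    ((WeylAlgebra.D i : WeylAlgebra K n) • φ : starHomSubmodule M N) =
      ⟨homD M N i φ, homD_mem_starHom M N i _ φ.2⟩ := by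
  change starHomAction M N (WeylAlgebra.D i) φ = _
  rw [starHomAction, WeylAlgebra.lift_D]
  rfl

/-- The graded `A_n(K)`-module `*Hom_R(M, N) = ⨁ Hom_d(M, N)`, with
`(X_i φ)(m) = X_i φ(m)` and `(∂_i φ)(m) = ∂_i φ(m) - φ(∂_i m)`. -/
def starHom (M : GradedWeylModule.{u, v} K n) (N : GradedWeylModule.{u, w} K n) :
    GradedWeylModule.{u, max v w} K n where
  carrier := starHomSubmodule M N
  grading d := (homDeg M N d).comap (starHomSubmodule M N).subtype
  isInternal := by
    refine isInternal_of_separating _ ?_ ?_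
    · rintro ⟨φ, hφ⟩
      have : starHomSubmodule M N ≤ (⨆ d, (homDeg M N d).comap
          (starHomSubmodule M N).subtype).map (starHomSubmodule M N).subtype :=
        iSup_le fun d ψ hψ => ⟨⟨ψ, Submodule.mem_iSup_of_mem d hψ⟩,
          Submodule.mem_iSup_of_mem d hψ, rfl⟩
      obtain ⟨ψ, hψ, rfl⟩ := this hφ
      exact hψ
    · rintro d ⟨φ, hφ⟩ hφd h0
      have h1 : ∃ e, ∃ m ∈ M.grading e, φ m ≠ 0 := by
        by_contra! h
        refine h0 (Subtype.ext (M.linearMap_ext fun e m hm => h e m hm))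
      obtain ⟨e, m, hm, hne⟩ := h1
      refine ⟨N, inferInstance, inferInstance,
        N.proj (e + d) ∘ₗ
          LinearMap.applyₗ m ∘ₗ (starHomSubmodule M N).subtype, ?_, ?_⟩
      · rintro k hk ⟨ψ, hψ⟩ hψk
        have : N.proj (e + d) (ψ m) = 0 := proj_of_mem_ne _ (hψk.2 e m hm) (by omega)
        exact this
      · have : N.proj (e + d) (φ m) = φ m := proj_of_mem _ (hφd.2 e m hm)
        exact fun h => hne (this.symm.trans h)
  gradedSMul := by
    refine gradedSMul_of_gen _ ?_ ?_
    · intro i d e φ hφ h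
      rw [starHom_X_smul]
      exact homX_mem M N i hφ h
    · intro i d e φ hφ h
      rw [starHom_D_smul]
      exact homD_mem M N i hφ h

/-- Composition with a morphism `f` maps `Hom_d(M, N)` to `Hom_d(M, N')`. -/
theorem comp_mem_homDeg (M : GradedWeylModule.{u, v} K n) {N N' : GradedWeylModule.{u, w} K n}
    (f : Hom N N') {d : ℤ} {φ : M →ₗ[K] N} (hφ : φ ∈ homDeg M N d) :
    f.toLinearMap.restrictScalars K ∘ₗ φ ∈ homDeg M N' d :=
  ⟨fun i m => by simp [hφ.1], fun e m hm => f.map_mem _ _ (hφ.2 e m hm)⟩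

theorem comp_mem_starHom (M : GradedWeylModule.{u, v} K n) {N N' : GradedWeylModule.{u, w} K n}
    (f : Hom N N') : ∀ φ ∈ starHomSubmodule M N,
      LinearMap.compRight K (M := M) (f.toLinearMap.restrictScalars K) φ ∈
        starHomSubmodule M N' := by
  have : starHomSubmodule M N ≤ (starHomSubmodule M N').comap
      (LinearMap.compRight K (M := M) (f.toLinearMap.restrictScalars K)) :=
    iSup_le fun d φ hφ => Submodule.mem_iSup_of_mem d (comp_mem_homDeg M f hφ)
  exact this

/-- A `K`-linear map that commutes with all `X_i` and `∂_i` is `A_n(K)`-linear. -/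
theorem map_smul_of_gen {V : Type v} {W : Type w} [AddCommGroup V] [Module K V]
    [Module (WeylAlgebra K n) V] [IsScalarTower K (WeylAlgebra K n) V] [AddCommGroup W]
    [Module K W] [Module (WeylAlgebra K n) W] [IsScalarTower K (WeylAlgebra K n) W]
    (f : V →ₗ[K] W)
    (hX : ∀ (i : Fin n) (x : V), f ((WeylAlgebra.X i : WeylAlgebra K n) • x) =
      (WeylAlgebra.X i : WeylAlgebra K n) • f x)
    (hD : ∀ (i : Fin n) (x : V), f ((WeylAlgebra.D i : WeylAlgebra K n) • x) =
      (WeylAlgebra.D i : WeylAlgebra K n) • f x)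
    (a : WeylAlgebra K n) (x : V) : f (a • x) = a • f x := by
  obtain ⟨p, rfl⟩ : ∃ p, WeylAlgebra.mk K n p = a := RingQuot.mkAlgHom_surjective K _ a
  induction p using FreeAlgebra.induction generalizing x with
  | grade0 c => simp [AlgHom.commutes, algebraMap_smul]
  | grade1 s =>
    rcases s with i | i
    · exact hX i x
    · exact hD i x
  | mul a b ha hb => rw [map_mul, mul_smul, ha, hb, mul_smul]
  | add a b ha hb => rw [map_add, add_smul, map_add, ha, hb, add_smul]

/-- The morphism `*Hom_R(M, N) → *Hom_R(M, N')`, `φ ↦ f ∘ φ`, induced by `f : N → N'`. -/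
def starHomMap (M : GradedWeylModule.{u, v} K n) {N N' : GradedWeylModule.{u, w} K n}
    (f : Hom N N') : Hom (starHom M N) (starHom M N') where
  toLinearMap :=
    { toFun := fun φ => (⟨f.toLinearMap.restrictScalars K ∘ₗ φ.1,
        comp_mem_starHom M f φ.1 φ.2⟩ : starHomSubmodule M N')
      map_add' := fun φ ψ => Subtype.ext (LinearMap.comp_add _ _ _)
      map_smul' := fun a φ => by
        refine map_smul_of_gen (V := starHomSubmodule M N) (W := starHomSubmodule M N')
          ((LinearMap.compRight K (M := M) (f.toLinearMap.restrictScalars K)).restrict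
            (comp_mem_starHom M f)) ?_ ?_ a φ
        · intro i φ
          rw [starHom_X_smul, starHom_X_smul]
          ext m
          simp [homX_apply]
        · intro i φ
          rw [starHom_D_smul, starHom_D_smul]
          ext m
          simp [homD_apply] }
  map_mem _ _ hφ := comp_mem_homDeg M f hφ

end

/-! ### Injective resolutions and graded Ext -/

/-- `E` is `*injective`, i.e. an injective object of the category of graded `A_n(K)`-modules. -/
def IsInjective {K : Type u} [Field K] {n : ℕ} (E : GradedWeylModule.{u, v} K n) : Prop :=
  ∀ (U V : GradedWeylModule.{u, v} K n) (j : Hom U V) (f : Hom U E),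
    Function.Injective j → ∃ g : Hom V E, ∀ x, g (j x) = f x

/-- A resolution `0 → N → I^0 → I^1 → ⋯` of `N` by `*injective` graded `A_n(K)`-modules. -/
structure InjectiveResolution {K : Type u} [Field K] {n : ℕ} (N : GradedWeylModule.{u, v} K n) where
  I : ℕ → GradedWeylModule.{u, v} K n
  isInjective : ∀ k, (I k).IsInjective
  ε : Hom N (I 0)
  d : ∀ k, Hom (I k) (I (k + 1))
  ε_injective : Function.Injective ε
  exact_zero : Function.Exact ε (d 0)
  exact_succ : ∀ k, Function.Exact (d k) (d (k + 1))

/-! ### Existence of injective resolutions -/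

section

variable {K : Type u} [Field K] {n : ℕ}

/-- The `K`-linear maps `A_n(K) → N` that are homogeneous of degree `d`. -/
def coindDeg (N : GradedWeylModule.{u, w} K n) (d : ℤ) : Submodule K (WeylAlgebra K n →ₗ[K] N) where
  carrier := {φ | ∀ e, ∀ a ∈ WeylAlgebra.grading K n e, φ a ∈ N.grading (e + d)}
  zero_mem' := fun _ _ _ => zero_mem _
  add_mem' := fun h1 h2 e a ha => add_mem (h1 e a ha) (h2 e a ha)
  smul_mem' := fun _ _ h e a ha => Submodule.smul_mem _ _ (h e a ha)

/-- The underlying space of `*Hom_K(A_n(K), N)`. -/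
def coindSubmodule (N : GradedWeylModule.{u, w} K n) : Submodule K (WeylAlgebra K n →ₗ[K] N) :=
  ⨆ d, coindDeg N d

theorem coindDeg_smul (N : GradedWeylModule.{u, w} K n) {c d : ℤ} {a : WeylAlgebra K n}
    (ha : a ∈ WeylAlgebra.grading K n c) {φ : WeylAlgebra K n →ₗ[K] N} (hφ : φ ∈ coindDeg N d) :
    φ ∘ₗ LinearMap.mulRight K a ∈ coindDeg N (c + d) := fun e b hb => by
  have := hφ (e + c) (b * a) (SetLike.GradedMul.mul_mem hb ha)
  rwa [add_assoc] at this

theorem coind_smul_mem (N : GradedWeylModule.{u, w} K n) (a : WeylAlgebra K n)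
    (φ : WeylAlgebra K n →ₗ[K] N) (hφ : φ ∈ coindSubmodule N) :
    φ ∘ₗ LinearMap.mulRight K a ∈ coindSubmodule N := by
  obtain ⟨p, rfl⟩ : ∃ p, WeylAlgebra.mk K n p = a := RingQuot.mkAlgHom_surjective K _ a
  have key : ∀ {c : ℤ} {a : WeylAlgebra K n} (_ : a ∈ WeylAlgebra.grading K n c)
      (φ : WeylAlgebra K n →ₗ[K] N) (_ : φ ∈ coindSubmodule N),
      φ ∘ₗ LinearMap.mulRight K a ∈ coindSubmodule N := by
    intro c a ha
    have : coindSubmodule N ≤ (coindSubmodule N).comap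
        (LinearMap.lcomp K N (LinearMap.mulRight K a)) :=
      iSup_le fun d φ hφ => Submodule.mem_iSup_of_mem (c + d) (coindDeg_smul N ha hφ)
    exact this
  induction p using FreeAlgebra.induction generalizing φ with
  | grade0 c =>
    have : φ ∘ₗ LinearMap.mulRight K (WeylAlgebra.mk K n (algebraMap K _ c)) = c • φ := by
      ext b
      simp [AlgHom.commutes, ← Algebra.commutes, ← Algebra.smul_def]
    rw [this]
    exact Submodule.smul_mem _ _ hφ
  | grade1 s => exact key (WeylAlgebra.gen_mem_grading s) φ hφ
  | mul a b ha hb =>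
    have : φ ∘ₗ LinearMap.mulRight K (WeylAlgebra.mk K n (a * b)) =
        (φ ∘ₗ LinearMap.mulRight K (WeylAlgebra.mk K n b)) ∘ₗ
          LinearMap.mulRight K (WeylAlgebra.mk K n a) := by
      ext x
      simp [mul_assoc]
    rw [this]
    exact ha _ (hb _ hφ)
  | add a b ha hb =>
    have : φ ∘ₗ LinearMap.mulRight K (WeylAlgebra.mk K n (a + b)) =
        φ ∘ₗ LinearMap.mulRight K (WeylAlgebra.mk K n a) +
          φ ∘ₗ LinearMap.mulRight K (WeylAlgebra.mk K n b) := by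
      ext x
      simp [mul_add]
    rw [this]
    exact add_mem (ha _ hφ) (hb _ hφ)

instance coindModule (N : GradedWeylModule.{u, w} K n) :
    Module (WeylAlgebra K n) (coindSubmodule N) where
  smul a φ := ⟨φ.1 ∘ₗ LinearMap.mulRight K a, coind_smul_mem N a φ.1 φ.2⟩
  one_smul φ := Subtype.ext (LinearMap.ext fun b => congrArg φ.1 (mul_one b))
  mul_smul a b φ := Subtype.ext (LinearMap.ext fun c => congrArg φ.1 (mul_assoc c a b).symm)
  smul_zero _ := rfl
  smul_add _ _ _ := rfl
  add_smul a b φ := Subtype.ext (LinearMap.ext fun c =>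
    (congrArg φ.1 (mul_add c a b)).trans (map_add φ.1 _ _))
  zero_smul φ := Subtype.ext (LinearMap.ext fun c =>
    (congrArg φ.1 (mul_zero c)).trans (map_zero φ.1))

theorem coind_smul_apply {N : GradedWeylModule.{u, w} K n} (a b : WeylAlgebra K n)
    (φ : coindSubmodule N) : (a • φ).1 b = φ.1 (b * a) := rfl

instance (N : GradedWeylModule.{u, w} K n) :
    IsScalarTower K (WeylAlgebra K n) (coindSubmodule N) :=
  ⟨fun c a φ => Subtype.ext (LinearMap.ext fun b => by
    change φ.1 (b * (c • a)) = c • φ.1 (b * a)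
    rw [mul_smul_comm, map_smul])⟩

/-- The graded module `*Hom_K(A_n(K), N)`, with `(a φ)(b) = φ(b a)`. -/
def coind (N : GradedWeylModule.{u, w} K n) : GradedWeylModule.{u, max u w} K n where
  carrier := coindSubmodule N
  grading d := (coindDeg N d).comap (coindSubmodule N).subtype
  isInternal := by
    refine isInternal_of_separating _ ?_ ?_
    · rintro ⟨φ, hφ⟩
      have : coindSubmodule N ≤ (⨆ d, (coindDeg N d).comap
          (coindSubmodule N).subtype).map (coindSubmodule N).subtype :=
        iSup_le fun d ψ hψ => ⟨⟨ψ, Submodule.mem_iSup_of_mem d hψ⟩,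
          Submodule.mem_iSup_of_mem d hψ, rfl⟩
      obtain ⟨ψ, hψ, rfl⟩ := this hφ
      exact hψ
    · rintro d ⟨φ, hφ⟩ hφd h0
      have h1 : ∃ e, ∃ a ∈ WeylAlgebra.grading K n e, φ a ≠ 0 := by
        by_contra! h
        refine h0 (Subtype.ext (LinearMap.ext fun a => ?_))
        have hle : (⨆ e, WeylAlgebra.grading K n e) ≤ LinearMap.ker φ :=
          iSup_le fun e a ha => h e a ha
        have hint := DirectSum.Decomposition.isInternal (WeylAlgebra.grading K n)
        rw [hint.submodule_iSup_eq_top] at hle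
        exact hle trivial
      obtain ⟨e, m, hm, hne⟩ := h1
      refine ⟨N, inferInstance, inferInstance, N.proj (e + d) ∘ₗ
          LinearMap.applyₗ m ∘ₗ (coindSubmodule N).subtype, ?_, ?_⟩
      · rintro k hk ⟨ψ, hψ⟩ hψk
        have : N.proj (e + d) (ψ m) = 0 := proj_of_mem_ne _ (hψk e m hm) (by omega)
        exact this
      · have : N.proj (e + d) (φ m) = φ m := proj_of_mem _ (hφd e m hm)
        exact fun h => hne (this.symm.trans h)
  gradedSMul := by
    refine gradedSMul_of_gen _ ?_ ?_
    · rintro i d e φ hφ rfl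
      have := coindDeg_smul N (WeylAlgebra.X_mem_grading i) hφ
      rwa [add_comm] at this
    · rintro i d e φ hφ rfl
      have := coindDeg_smul N (WeylAlgebra.D_mem_grading i) hφ
      rwa [neg_add_eq_sub] at this

theorem mem_coind (V : GradedWeylModule.{u, v} K n) (N : GradedWeylModule.{u, w} K n)
    (h : V →ₗ[K] N) (hh : ∀ d, ∀ x ∈ V.grading d, h x ∈ N.grading d) (x : V) :
    (h ∘ₗ (Algebra.lsmul K K V).toLinearMap.flip x) ∈ coindSubmodule N := by
  have : (⨆ d, V.grading d) ≤ (coindSubmodule N).comap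
      ((LinearMap.llcomp K (WeylAlgebra K n) V N h) ∘ₗ (Algebra.lsmul K K V).toLinearMap.flip) :=
    iSup_le fun d x hx => Submodule.mem_iSup_of_mem d fun e a ha =>
      hh _ _ (V.gradedSMul.smul_mem ha hx)
  exact this (V.mem_iSup_grading x)

/-- The morphism `V → *Hom_K(A_n(K), N)` that corresponds to a `K`-linear map `V → N`
of degree `0`. -/
def toCoind (V : GradedWeylModule.{u, v} K n) (N : GradedWeylModule.{u, w} K n)
    (h : V →ₗ[K] N) (hh : ∀ d, ∀ x ∈ V.grading d, h x ∈ N.grading d) : Hom V (coind N) where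
  toLinearMap :=
    { toFun := fun x => (⟨_, mem_coind V N h hh x⟩ : coindSubmodule N)
      map_add' := fun x y => Subtype.ext (LinearMap.ext fun a => by
        change h (a • (x + y)) = h (a • x) + h (a • y)
        rw [smul_add, map_add])
      map_smul' := fun b x => Subtype.ext (LinearMap.ext fun a => by
        change h (a • b • x) = h ((a * b) • x)
        rw [mul_smul]) }
  map_mem := fun d x hx e a ha => hh _ _ (V.gradedSMul.smul_mem ha hx)

theorem exists_graded_extend {U V : GradedWeylModule.{u, v} K n} {N : GradedWeylModule.{u, w} K n}
    (j : Hom U V) (hj : Function.Injective j) (f : U →ₗ[K] N)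
    (hf : ∀ d, ∀ x ∈ U.grading d, f x ∈ N.grading d) :
    ∃ h : V →ₗ[K] N, (∀ d, ∀ x ∈ V.grading d, h x ∈ N.grading d) ∧ ∀ x, h (j x) = f x := by
  obtain ⟨r, hr⟩ := LinearMap.exists_leftInverse_of_injective
    (j.toLinearMap.restrictScalars K) (LinearMap.ker_eq_bot.mpr hj)
  let h : V →ₗ[K] N := DirectSum.toModule K ℤ N
      (fun d => N.proj d ∘ₗ f ∘ₗ r ∘ₗ (V.grading d).subtype) ∘ₗ
    (LinearEquiv.ofBijective (DirectSum.coeLinearMap V.grading) V.isInternal).symm.toLinearMap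
  have key : ∀ d, ∀ x ∈ V.grading d, h x = N.proj d (f (r x)) := by
    intro d x hx
    have : (LinearEquiv.ofBijective (DirectSum.coeLinearMap V.grading) V.isInternal).symm x =
        DirectSum.lof K ℤ (fun d => V.grading d) d ⟨x, hx⟩ := by
      rw [LinearEquiv.symm_apply_eq]
      exact (DirectSum.coeLinearMap_lof V.grading d (⟨x, hx⟩ : V.grading d)).symm
    change DirectSum.toModule K ℤ N _ ((LinearEquiv.ofBijective
      (DirectSum.coeLinearMap V.grading) V.isInternal).symm x) = _
    rw [this, DirectSum.toModule_lof]
    rfl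
  refine ⟨h, fun d x hx => by rw [key d x hx]; exact N.proj_mem _ _, fun x => ?_⟩
  have : h ∘ₗ j.toLinearMap.restrictScalars K = f := by
    refine U.linearMap_ext fun d x hx => ?_
    have hrx : r (j x) = x := LinearMap.congr_fun hr x
    change h (j x) = f x
    rw [key d _ (j.map_mem d x hx), hrx, proj_of_mem _ (hf d x hx)]
  exact LinearMap.congr_fun this x

theorem coind_isInjective (N : GradedWeylModule.{u, w} K n) : (coind N).IsInjective := by
  intro U V j f hj
  let ev : coind N →ₗ[K] N := LinearMap.applyₗ 1 ∘ₗ (coindSubmodule N).subtype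
  obtain ⟨h, hh, hj'⟩ := exists_graded_extend j hj (ev ∘ₗ f.toLinearMap.restrictScalars K)
    (fun d x hx => by
      have := f.map_mem d x hx 0 1 SetLike.GradedOne.one_mem
      rwa [zero_add] at this)
  refine ⟨toCoind V N h hh, fun x => Subtype.ext (LinearMap.ext fun a => ?_)⟩
  change h (a • j x) = (f x).1 a
  have h1 : a • j x = j (a • x) := (map_smul j.toLinearMap a x).symm
  have h2 : f (a • x) = a • f x := map_smul f.toLinearMap a x
  rw [h1, hj']
  change (f (a • x)).1 1 = _
  rw [h2]
  exact congrArg (f x).1 (one_mul a)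

/-- There are enough `*injective` modules. -/
theorem exists_isInjective (N : GradedWeylModule.{u, max u w} K n) :
    ∃ (E : GradedWeylModule.{u, max u w} K n) (ε : Hom N E), E.IsInjective ∧
      Function.Injective ε := by
  refine ⟨coind N, toCoind N N LinearMap.id (fun _ _ h => h), coind_isInjective N, ?_⟩
  intro x y hxy
  have := LinearMap.congr_fun (congrArg Subtype.val hxy) (1 : WeylAlgebra K n)
  change (1 : WeylAlgebra K n) • x = (1 : WeylAlgebra K n) • y at this
  rwa [one_smul, one_smul] at this

/-- Every morphism has a cokernel. -/
theorem exists_coker {U V : GradedWeylModule.{u, v} K n} (f : Hom U V) :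
    ∃ (C : GradedWeylModule.{u, v} K n) (p : Hom V C), Function.Surjective p ∧
      Function.Exact f p := by
  let k : V →ₗ[WeylAlgebra K n] LinearMap.ker (Hom.zero V V).toLinearMap :=
    LinearMap.codRestrict _ LinearMap.id (fun _ => rfl)
  refine ⟨cohomology f (Hom.zero V V), ⟨Submodule.mkQ _ ∘ₗ k, ?_⟩, ?_, ?_⟩
  · intro d x hx
    exact ⟨k x, hx, rfl⟩
  · intro y
    obtain ⟨z, rfl⟩ := Submodule.mkQ_surjective _ y
    exact ⟨z.1, rfl⟩
  · intro x
    exact (Submodule.Quotient.mk_eq_zero _ (x := k x)).trans Iff.rfl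

/-- Every graded module has a resolution by `*injective` modules. -/
theorem nonempty_injectiveResolution (N : GradedWeylModule.{u, max u w} K n) :
    Nonempty (InjectiveResolution N) := by
  choose E ε hE hε using fun N : GradedWeylModule.{u, max u w} K n => exists_isInjective.{u, w} N
  choose C p hp hex using
    fun N : GradedWeylModule.{u, max u w} K n => exists_coker (ε N)
  let S : ℕ → GradedWeylModule.{u, max u w} K n := fun k => Nat.rec N (fun _ M => C M) k
  refine ⟨⟨fun k => E (S k), fun k => hE _, ε N, fun k =>
    ⟨(ε (S (k + 1))).toLinearMap ∘ₗ (p (S k)).toLinearMap, fun d x hx =>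
      (ε (S (k + 1))).map_mem _ _ ((p (S k)).map_mem _ _ hx)⟩, hε N, ?_, ?_⟩⟩
  · intro x
    refine Iff.trans ?_ (hex N x)
    exact map_eq_zero_iff (ε (C N)).toLinearMap (hε (C N)) (x := p N x)
  · intro k x
    refine Iff.trans (map_eq_zero_iff (ε (C (S (k + 1)))).toLinearMap (hε (C (S (k + 1))))
      (x := p (S (k + 1)) x)) ?_
    refine Iff.trans (hex (S (k + 1)) x) ?_
    constructor
    · rintro ⟨y, rfl⟩
      obtain ⟨z, rfl⟩ := hp (S k) y
      exact ⟨z, rfl⟩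
    · rintro ⟨z, rfl⟩
      exact ⟨p (S k) z, rfl⟩

end

/-! ### The graded Ext modules -/

/-- `*Ext^i_R(M, N)`, as a graded `A_n(K)`-module: the `i`-th cohomology module of the complex
`0 → *Hom_R(M, I^0) → *Hom_R(M, I^1) → ⋯` for a resolution `I` of `N` by `*injective` graded
`A_n(K)`-modules. -/
def starExt {K : Type u} [Field K] {n : ℕ} (M : GradedWeylModule.{u, w} K n)
    {N : GradedWeylModule.{u, v} K n} (J : InjectiveResolution N) :
    ℕ → GradedWeylModule.{u, max w v} K n
  | 0 => cohomology (Hom.zero (starHom M (J.I 0)) (starHom M (J.I 0))) (starHomMap M (J.d 0))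
  | i + 1 => cohomology (starHomMap M (J.d i)) (starHomMap M (J.d (i + 1)))

end GradedWeylModule

end

noncomputable section

/-! ### Commutators of the Euler operator with the generators. -/

namespace WeylAlgebra

variable {K : Type u} [Field K] {n : ℕ}

/-! On a graded module `P`, let `ε_P` send a homogeneous `x` to `(E - deg x) x`, where `E` is the
Euler operator. The commutators `[E, X_j] = X_j` and `[E, ∂_j] = -∂_j` exactly offset the degree
shifts of the generators, so `ε_P` is `A_n(K)`-linear of degree 0 (`eulerDefect`). Morphisms of
graded modules commute with it (`Hom.map_eulerDefect`). Being strongly generalized Eulerian means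
that `ε_P` is nilpotent, so the theorem becomes a statement about a natural endomorphism of graded
modules.

On `*Hom_R(M, V)` this endomorphism is `φ ↦ ε_V ∘ φ - φ ∘ ε_M` (`starHom_eulerDefect`), a difference
of two commuting operators. If `ε_M^a = 0`, then the `a`-th power of the second one vanishes. If
`ε_N^b = 0`, then `ε^b` on an injective resolution of `N` is a chain map lifting zero, hence null
homotopic through morphisms of graded modules (`InjectiveResolution.exists_homotopy_zero`,
`InjectiveResolution.exists_homotopy_succ`), so composing with it sends cocycles of `*Hom_R(M, I^•)`
to coboundaries.

In the binomial expansion of the `(a+b)`-th power of the difference, each term contains either the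
`a`-th power of precomposition or the `b`-th power of postcomposition. Hence this power annihilates
cohomology (`exists_comp_eq_postEuler_sub_preEuler_pow`). -/

theorem euler_mul_X (j : Fin n) :
    (euler K n * X j : WeylAlgebra K n) = X j * euler K n + X j := by
  have h (i : Fin n) : (X i * D i * X j : WeylAlgebra K n) =
      X j * (X i * D i) + if i = j then X i else 0 := by
    rw [mul_assoc, D_mul_X, mul_add, ← mul_assoc, ← mul_assoc, X_mul_X i j]
    split_ifs <;> simp
  simp [euler, Finset.sum_mul, Finset.mul_sum, h, Finset.sum_add_distrib]

theorem euler_mul_D (j : Fin n) :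
    (euler K n * D j : WeylAlgebra K n) = D j * euler K n - D j := by
  -- Here it is `∂_j E`, on the right-hand side, that has to be normally ordered; the correction
  -- terms sum to `∂_j`.
  have h (i : Fin n) : (D j * (X i * D i) : WeylAlgebra K n) =
      X i * D i * D j + if j = i then D i else 0 := by
    rw [← mul_assoc, D_mul_X, add_mul, mul_assoc, D_mul_D j i, ← mul_assoc]
    split_ifs <;> simp
  simp [euler, Finset.sum_mul, Finset.mul_sum, h, Finset.sum_add_distrib]

end WeylAlgebra

namespace GradedWeylModule

section

variable {K : Type u} [Field K] {n : ℕ}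

/-! ### The Eulerian endomorphism of a graded module -/

/-- The `K`-linear map that multiplies elements of degree `d` by `d`. -/
def degreeMap (P : GradedWeylModule.{u, v} K n) : P →ₗ[K] P :=
  DirectSum.toModule K ℤ P (fun d => (d : K) • (P.grading d).subtype) ∘ₗ
    (LinearEquiv.ofBijective (DirectSum.coeLinearMap P.grading) P.isInternal).symm.toLinearMap

theorem degreeMap_of_mem (P : GradedWeylModule.{u, v} K n) {d : ℤ} {x : P}
    (hx : x ∈ P.grading d) : P.degreeMap x = (d : K) • x := by
  have : (LinearEquiv.ofBijective (DirectSum.coeLinearMap P.grading) P.isInternal).symm x =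
      DirectSum.lof K ℤ (fun d => P.grading d) d ⟨x, hx⟩ := by
    rw [LinearEquiv.symm_apply_eq]
    exact (DirectSum.coeLinearMap_lof P.grading d (⟨x, hx⟩ : P.grading d)).symm
  change DirectSum.toModule K ℤ P _ ((LinearEquiv.ofBijective
    (DirectSum.coeLinearMap P.grading) P.isInternal).symm x) = _
  rw [this, DirectSum.toModule_lof]
  rfl

/-- The `K`-linear map that sends an element `x` of degree `d` to `(∑ X_i ∂_i - d) x`. -/
def eulerDefectLinear (P : GradedWeylModule.{u, v} K n) : P →ₗ[K] P :=
  actionMap P (WeylAlgebra.euler K n) - P.degreeMap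

theorem eulerDefectLinear_of_mem (P : GradedWeylModule.{u, v} K n) {d : ℤ} {x : P}
    (hx : x ∈ P.grading d) :
    P.eulerDefectLinear x = WeylAlgebra.euler K n • x - (d : K) • x := by
  rw [eulerDefectLinear, LinearMap.sub_apply, degreeMap_of_mem P hx]
  rfl

/-- Reconciles the two roles of the integer `d`: an element of `A_n(K)` in the Eulerian condition, a
scalar of `K` in `degreeMap`. Both act as the integer multiple. -/
theorem euler_sub_smul (P : GradedWeylModule.{u, v} K n) (d : ℤ) (x : P) :
    (WeylAlgebra.euler K n - (d : WeylAlgebra K n)) • x =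
      WeylAlgebra.euler K n • x - (d : K) • x := by
  rw [sub_smul, Int.cast_smul_eq_zsmul, Int.cast_smul_eq_zsmul]

theorem euler_smul_mem (P : GradedWeylModule.{u, v} K n) {d : ℤ} {x : P}
    (hx : x ∈ P.grading d) : WeylAlgebra.euler K n • x ∈ P.grading d := by
  rw [WeylAlgebra.euler, Finset.sum_smul]
  refine Submodule.sum_mem _ fun i _ => ?_
  rw [mul_smul]
  exact P.X_smul_mem i (P.D_smul_mem i hx rfl) (by omega)

/-- The endomorphism of a graded module that sends an element `x` of degree `d` to
`(∑ X_i ∂_i - d) x`. -/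
def eulerDefect (P : GradedWeylModule.{u, v} K n) : Hom P P where
  toLinearMap :=
    { toFun := P.eulerDefectLinear
      map_add' := map_add _
      map_smul' := by
        refine map_smul_of_gen P.eulerDefectLinear (fun i x => ?_) (fun i x => ?_)
        · have : P.eulerDefectLinear ∘ₗ actionMap P (WeylAlgebra.X i) =
              actionMap P (WeylAlgebra.X i) ∘ₗ P.eulerDefectLinear := by
            refine P.linearMap_ext fun d x hx => ?_
            change P.eulerDefectLinear ((WeylAlgebra.X i : WeylAlgebra K n) • x) =
              (WeylAlgebra.X i : WeylAlgebra K n) • P.eulerDefectLinear x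
            -- The extra `X_i x` from the commutator cancels against the 1 in the new degree `d +
            -- 1`; for `∂_i` the signs are reversed.
            rw [eulerDefectLinear_of_mem P hx, eulerDefectLinear_of_mem P (P.X_smul_mem i hx rfl),
              ← mul_smul, WeylAlgebra.euler_mul_X, add_smul, mul_smul, smul_sub,
              smul_algebra_smul_comm, Int.cast_add, add_smul, Int.cast_one, one_smul]
            abel
          exact LinearMap.congr_fun this x
        · have : P.eulerDefectLinear ∘ₗ actionMap P (WeylAlgebra.D i) =
              actionMap P (WeylAlgebra.D i) ∘ₗ P.eulerDefectLinear := by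
            refine P.linearMap_ext fun d x hx => ?_
            change P.eulerDefectLinear ((WeylAlgebra.D i : WeylAlgebra K n) • x) =
              (WeylAlgebra.D i : WeylAlgebra K n) • P.eulerDefectLinear x
            rw [eulerDefectLinear_of_mem P hx, eulerDefectLinear_of_mem P (P.D_smul_mem i hx rfl),
              ← mul_smul, WeylAlgebra.euler_mul_D, sub_smul, mul_smul, smul_sub,
              smul_algebra_smul_comm, Int.cast_sub, sub_smul, Int.cast_one, one_smul]
            abel
          exact LinearMap.congr_fun this x }
  map_mem d x hx := by
    change P.eulerDefectLinear x ∈ _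
    rw [eulerDefectLinear_of_mem P hx]
    exact sub_mem (P.euler_smul_mem hx) (Submodule.smul_mem _ _ hx)

theorem eulerDefect_of_mem (P : GradedWeylModule.{u, v} K n) {d : ℤ} {x : P}
    (hx : x ∈ P.grading d) :
    P.eulerDefect x = (WeylAlgebra.euler K n - (d : WeylAlgebra K n)) • x := by
  rw [euler_sub_smul]
  exact eulerDefectLinear_of_mem P hx

/-- The powers of an endomorphism of a graded module. -/
def Hom.pow {P : GradedWeylModule.{u, v} K n} (f : Hom P P) : ℕ → Hom P P
  | 0 => ⟨LinearMap.id, fun _ _ h => h⟩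
  | k + 1 => ⟨f.toLinearMap ∘ₗ (f.pow k).toLinearMap,
      fun d x hx => f.map_mem d _ ((f.pow k).map_mem d x hx)⟩

theorem Hom.pow_succ_apply {P : GradedWeylModule.{u, v} K n} (f : Hom P P) (k : ℕ) (x : P) :
    f.pow (k + 1) x = f (f.pow k x) := rfl

/-- The endomorphism preserves degrees, so every iteration subtracts the same `d`. This translates
between the Eulerian condition and powers of the endomorphism. -/
theorem eulerDefect_pow_of_mem (P : GradedWeylModule.{u, v} K n) {d : ℤ} {x : P}
    (hx : x ∈ P.grading d) (k : ℕ) :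
    P.eulerDefect.pow k x = (WeylAlgebra.euler K n - (d : WeylAlgebra K n)) ^ k • x := by
  induction k with
  | zero =>
    rw [pow_zero, one_smul]
    rfl
  | succ k ih =>
    rw [Hom.pow_succ_apply, eulerDefect_of_mem P ((P.eulerDefect.pow k).map_mem d x hx), ih,
      ← mul_smul, pow_succ']

/-- A strongly generalized Eulerian module has a nilpotent Eulerian endomorphism. -/
theorem eulerDefect_pow_eq_zero (P : GradedWeylModule.{u, v} K n) {a : ℕ}
    (ha : ∀ (d : ℤ) (x : P), x ∈ P.grading d →
      (WeylAlgebra.euler K n - (d : WeylAlgebra K n)) ^ a • x = 0) (x : P) :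
    P.eulerDefect.pow a x = 0 := by
  -- The exponent `a` is uniform in the degree, so vanishing on homogeneous elements suffices.
  have : (P.eulerDefect.pow a).toLinearMap.restrictScalars K = 0 :=
    P.linearMap_ext fun d x hx => by
      change P.eulerDefect.pow a x = 0
      rw [eulerDefect_pow_of_mem P hx, ha d x hx]
  exact LinearMap.congr_fun this x

/-- The Eulerian endomorphism commutes with all morphisms. -/
theorem Hom.map_eulerDefect {P : GradedWeylModule.{u, v} K n} {Q : GradedWeylModule.{u, w} K n}
    (f : Hom P Q) (x : P) : f (P.eulerDefect x) = Q.eulerDefect (f x) := by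
  have : f.toLinearMap.restrictScalars K ∘ₗ P.eulerDefect.toLinearMap.restrictScalars K =
      Q.eulerDefect.toLinearMap.restrictScalars K ∘ₗ f.toLinearMap.restrictScalars K := by
    refine P.linearMap_ext fun d x hx => ?_
    change f (P.eulerDefect x) = Q.eulerDefect (f x)
    -- Since `f` preserves degrees, the same element `E - d` of `A_n(K)` acts on both sides.
    rw [eulerDefect_of_mem P hx, eulerDefect_of_mem Q (f.map_mem d x hx), map_smul]
  exact LinearMap.congr_fun this x

theorem Hom.map_eulerDefect_pow {P : GradedWeylModule.{u, v} K n}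
    {Q : GradedWeylModule.{u, w} K n} (f : Hom P Q) (k : ℕ) (x : P) :
    f (P.eulerDefect.pow k x) = Q.eulerDefect.pow k (f x) := by
  induction k with
  | zero => rfl
  | succ k ih => rw [Hom.pow_succ_apply, Hom.pow_succ_apply, Hom.map_eulerDefect, ih]

/-! ### Null homotopies -/

/-- A morphism that vanishes on the image of `f` factors through a cokernel of `f`. -/
theorem Hom.exists_factor {U V C W : GradedWeylModule.{u, v} K n} {f : Hom U V} {p : Hom V C}
    (hp : Function.Surjective p) (hfp : Function.Exact f p) (g : Hom V W)
    (hg : ∀ x, g (f x) = 0) : ∃ h : Hom C W, ∀ x, h (p x) = g x := by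
  have hk : LinearMap.ker p.toLinearMap ≤ LinearMap.ker g.toLinearMap := by
    intro x hx
    obtain ⟨y, rfl⟩ := (hfp x).mp hx
    exact hg y
  let e := p.toLinearMap.quotKerEquivOfSurjective hp
  let h : C →ₗ[WeylAlgebra K n] W :=
    (LinearMap.ker p.toLinearMap).liftQ g.toLinearMap hk ∘ₗ e.symm.toLinearMap
  have key : ∀ x, h (p x) = g x := by
    intro x
    have : e.symm (p x) = (LinearMap.ker p.toLinearMap).mkQ x := by
      rw [LinearEquiv.symm_apply_eq]
      rfl
    change (LinearMap.ker p.toLinearMap).liftQ g.toLinearMap hk (e.symm (p x)) = _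
    rw [this]
    rfl
  refine ⟨⟨h, fun d c hc => ?_⟩, key⟩
  obtain ⟨x, rfl⟩ := hp c
  -- The preimage `x` need not be homogeneous; its component of degree `d` has the same image in
  -- `C`.
  rw [← proj_of_mem C hc, ← Hom.map_proj, key]
  exact g.map_mem d _ (V.proj_mem d x)

/-- Maps into a `*injective` module extend along an exact sequence. -/
theorem IsInjective.exists_extend {U V W E : GradedWeylModule.{u, v} K n} (hE : E.IsInjective)
    {f : Hom U V} {g : Hom V W} (hfg : Function.Exact f g) (φ : Hom V E)
    (hφ : ∀ x, φ (f x) = 0) : ∃ h : Hom W E, ∀ x, h (g x) = φ x := by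
  -- By exactness the cokernel of `f` embeds in `W` through `g`. The map `φ` descends to this
  -- cokernel and then extends to `W` by injectivity of `E`.
  obtain ⟨C, p, hp, hfp⟩ := exists_coker f
  obtain ⟨j, hj⟩ := Hom.exists_factor hp hfp g fun x => (hfg _).mpr ⟨x, rfl⟩
  obtain ⟨φ', hφ'⟩ := Hom.exists_factor hp hfp φ hφ
  have hinj : Function.Injective j := by
    refine (injective_iff_map_eq_zero j.toLinearMap).mpr fun c hc => ?_
    obtain ⟨x, rfl⟩ := hp c
    exact (hfp x).mpr ((hfg x).mp ((hj x).symm.trans hc))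
  obtain ⟨h, hh⟩ := hE C W j φ' hinj
  exact ⟨h, fun x => by rw [← hj, hh, hφ']⟩

/-- `φ - f ∘ h`. -/
def Hom.subComp {V W E : GradedWeylModule.{u, v} K n} (φ : Hom V E) (f : Hom W E)
    (h : Hom V W) : Hom V E where
  toLinearMap := φ.toLinearMap - f.toLinearMap ∘ₗ h.toLinearMap
  map_mem d x hx := sub_mem (φ.map_mem d x hx) (f.map_mem d _ (h.map_mem d x hx))

/-- If the `b`-th power of the Eulerian endomorphism of `N` vanishes, then that of an injective
resolution of `N` is null homotopic in degree `0`. -/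
theorem InjectiveResolution.exists_homotopy_zero {N : GradedWeylModule.{u, v} K n}
    (J : InjectiveResolution N) {b : ℕ} (hb : ∀ x : N, N.eulerDefect.pow b x = 0) :
    ∃ h : Hom (J.I 1) (J.I 0), ∀ x, (J.I 0).eulerDefect.pow b x = h (J.d 0 x) := by
  -- By naturality, `ε^b` on `I^0` restricts on `N` to `ε_N^b = 0`.
  obtain ⟨h, hh⟩ := (J.isInjective 0).exists_extend J.exact_zero ((J.I 0).eulerDefect.pow b)
    fun x => by rw [← Hom.map_eulerDefect_pow, hb, map_zero]
  exact ⟨h, fun x => (hh x).symm⟩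

/-- If the `b`-th power of the Eulerian endomorphism of `N` vanishes, then that of an injective
resolution of `N` is null homotopic in positive degrees. -/
theorem InjectiveResolution.exists_homotopy_succ {N : GradedWeylModule.{u, v} K n}
    (J : InjectiveResolution N) {b : ℕ} (hb : ∀ x : N, N.eulerDefect.pow b x = 0) (k : ℕ) :
    ∃ (h' : Hom (J.I (k + 1)) (J.I k)) (h : Hom (J.I (k + 2)) (J.I (k + 1))),
      ∀ x, (J.I (k + 1)).eulerDefect.pow b x = J.d k (h' x) + h (J.d (k + 1) x) := by
  -- The hypothesis is the homotopy relation one degree lower after applying `d^k`, which removes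
  -- the term coming from `d^{k-1}`. In this form it also makes sense for `k = 0`.
  have step : ∀ (k : ℕ) (h' : Hom (J.I (k + 1)) (J.I k)),
      (∀ x, J.d k ((J.I k).eulerDefect.pow b x) = J.d k (h' (J.d k x))) →
      ∃ h : Hom (J.I (k + 2)) (J.I (k + 1)),
        ∀ x, (J.I (k + 1)).eulerDefect.pow b x = J.d k (h' x) + h (J.d (k + 1) x) := by
    intro k h' hh'
    -- The map `ε^b - d^k h'` vanishes on the image of `d^k`, so it factors through `d^{k+1}`.
    obtain ⟨h, hh⟩ := (J.isInjective (k + 1)).exists_extend (J.exact_succ k)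
      (((J.I (k + 1)).eulerDefect.pow b).subComp (J.d k) h') fun x => by
        change (J.I (k + 1)).eulerDefect.pow b (J.d k x) - J.d k (h' (J.d k x)) = 0
        rw [← Hom.map_eulerDefect_pow, hh', sub_self]
    refine ⟨h, fun x => ?_⟩
    rw [hh]
    exact (add_sub_cancel _ _).symm
  -- Two consecutive homotopy maps are carried along, because the later one becomes the earlier one
  -- in the next degree.
  induction k with
  | zero =>
    obtain ⟨h', hh'⟩ := J.exists_homotopy_zero hb
    exact ⟨h', step 0 h' fun x => by rw [hh']⟩
  | succ k ih =>
    obtain ⟨h'', h', hh⟩ := ih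
    refine ⟨h', step (k + 1) h' fun x => ?_⟩
    have : J.d (k + 1) (J.d k (h'' x)) = 0 := (J.exact_succ k _).mpr ⟨_, rfl⟩
    rw [hh, map_add, this, zero_add]

/-! ### The Eulerian endomorphism of `*Hom` -/

/-- Composition with the Eulerian endomorphism of the target. -/
def postEuler (M : GradedWeylModule.{u, v} K n) (N : GradedWeylModule.{u, w} K n) :
    Module.End K (M →ₗ[K] N) :=
  LinearMap.compRight K (N.eulerDefect.toLinearMap.restrictScalars K)

/-- Composition with the Eulerian endomorphism of the source. -/
def preEuler (M : GradedWeylModule.{u, v} K n) (N : GradedWeylModule.{u, w} K n) :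
    Module.End K (M →ₗ[K] N) :=
  LinearMap.lcomp K N (M.eulerDefect.toLinearMap.restrictScalars K)

theorem postEuler_apply (M : GradedWeylModule.{u, v} K n) (N : GradedWeylModule.{u, w} K n)
    (φ : M →ₗ[K] N) (m : M) : postEuler M N φ m = N.eulerDefect (φ m) := rfl

theorem preEuler_apply (M : GradedWeylModule.{u, v} K n) (N : GradedWeylModule.{u, w} K n)
    (φ : M →ₗ[K] N) (m : M) : preEuler M N φ m = φ (M.eulerDefect m) := rfl

theorem postEuler_pow_apply (M : GradedWeylModule.{u, v} K n) (N : GradedWeylModule.{u, w} K n)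
    (k : ℕ) (φ : M →ₗ[K] N) (m : M) :
    (postEuler M N ^ k) φ m = N.eulerDefect.pow k (φ m) := by
  induction k with
  | zero => rfl
  | succ k ih => rw [pow_succ', Module.End.mul_apply, postEuler_apply, ih, Hom.pow_succ_apply]

theorem preEuler_pow_apply (M : GradedWeylModule.{u, v} K n) (N : GradedWeylModule.{u, w} K n)
    (k : ℕ) (φ : M →ₗ[K] N) (m : M) :
    (preEuler M N ^ k) φ m = φ (M.eulerDefect.pow k m) := by
  induction k generalizing φ with
  | zero => rfl
  | succ k ih => rw [pow_succ, Module.End.mul_apply, ih, preEuler_apply, Hom.pow_succ_apply]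

/-- Associativity of composition: the two operators act on opposite sides of `φ`. -/
theorem commute_postEuler_preEuler (M : GradedWeylModule.{u, v} K n)
    (N : GradedWeylModule.{u, w} K n) : Commute (postEuler M N) (preEuler M N) := rfl

theorem postEuler_pow_mem (M : GradedWeylModule.{u, v} K n) (N : GradedWeylModule.{u, w} K n)
    {d : ℤ} (k : ℕ) {φ : M →ₗ[K] N} (hφ : φ ∈ homDeg M N d) :
    (postEuler M N ^ k) φ ∈ homDeg M N d := by
  have : (postEuler M N ^ k) φ =
      (N.eulerDefect.pow k).toLinearMap.restrictScalars K ∘ₗ φ :=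
    LinearMap.ext fun m => postEuler_pow_apply M N k φ m
  rw [this]
  exact comp_mem_homDeg M _ hφ

theorem preEuler_pow_mem (M : GradedWeylModule.{u, v} K n) (N : GradedWeylModule.{u, w} K n)
    {d : ℤ} (k : ℕ) {φ : M →ₗ[K] N} (hφ : φ ∈ homDeg M N d) :
    (preEuler M N ^ k) φ ∈ homDeg M N d := by
  refine ⟨fun i m => ?_, fun e m hm => ?_⟩
  · rw [preEuler_pow_apply, preEuler_pow_apply, map_smul, hφ.1]
  · rw [preEuler_pow_apply]
    exact hφ.2 e _ ((M.eulerDefect.pow k).map_mem e m hm)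

/-- The term `X_i φ(∂_i m)` equals `φ(X_i ∂_i m)` because `φ` is `R`-linear; thus the second-order
operators `X_i ∂_i` act on maps by a commutator, as the `∂_i` do. -/
theorem starHom_euler_smul_apply {M : GradedWeylModule.{u, v} K n}
    {N : GradedWeylModule.{u, w} K n} {d : ℤ} (φ : starHomSubmodule M N)
    (hφ : φ.1 ∈ homDeg M N d) (m : M) :
    (WeylAlgebra.euler K n • φ).1 m =
      WeylAlgebra.euler K n • φ.1 m - φ.1 (WeylAlgebra.euler K n • m) := by
  have h (i : Fin n) : ((WeylAlgebra.X i * WeylAlgebra.D i : WeylAlgebra K n) • φ).1 m =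
      (WeylAlgebra.X i * WeylAlgebra.D i : WeylAlgebra K n) • φ.1 m -
        φ.1 ((WeylAlgebra.X i * WeylAlgebra.D i : WeylAlgebra K n) • m) := by
    rw [mul_smul, starHom_X_smul, starHom_D_smul]
    simp only [homX_apply, homD_apply]
    rw [smul_sub, mul_smul, mul_smul, ← hφ.1]
  simp only [WeylAlgebra.euler, Finset.sum_smul, map_sum, Submodule.coe_sum,
    LinearMap.sum_apply, ← Finset.sum_sub_distrib, ← h]

/-- For `m` of degree `e` the image `φ m` has degree `e + d`, so the degree corrections match: `(e +
d) - e = d`. -/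
theorem starHom_eulerDefect {M : GradedWeylModule.{u, v} K n}
    {N : GradedWeylModule.{u, w} K n} {d : ℤ} (φ : starHom M N)
    (hφ : φ ∈ (starHom M N).grading d) :
    ((starHom M N).eulerDefect φ).1 = (postEuler M N - preEuler M N) φ.1 := by
  refine M.linearMap_ext fun e m hm => ?_
  have hm' : φ.1 m ∈ N.grading (e + d) := hφ.2 e m hm
  rw [eulerDefect_of_mem _ hφ, euler_sub_smul]
  refine (congrArg (fun x => x - (d : K) • φ.1 m) (starHom_euler_smul_apply φ hφ m)).trans ?_
  change WeylAlgebra.euler K n • φ.1 m - φ.1 (WeylAlgebra.euler K n • m) - (d : K) • φ.1 m =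
    N.eulerDefect (φ.1 m) - φ.1 (M.eulerDefect m)
  rw [eulerDefect_of_mem _ hm, eulerDefect_of_mem _ hm',
    euler_sub_smul, euler_sub_smul, map_sub, φ.1.map_smul, Int.cast_add, add_smul]
  abel

theorem starHom_eulerDefect_pow {M : GradedWeylModule.{u, v} K n}
    {N : GradedWeylModule.{u, w} K n} {d : ℤ} (φ : starHom M N)
    (hφ : φ ∈ (starHom M N).grading d) (k : ℕ) :
    ((starHom M N).eulerDefect.pow k φ).1 = ((postEuler M N - preEuler M N) ^ k) φ.1 := by
  induction k with
  | zero => rfl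
  | succ k ih =>
    rw [Hom.pow_succ_apply, starHom_eulerDefect _ (((starHom M N).eulerDefect.pow k).map_mem d φ hφ),
      ih, pow_succ', Module.End.mul_apply]

/-! ### Cohomology of `*Hom` -/

/-- The nilpotency estimate on homogeneous cocycles of `*Hom_R(M, V)`. -/
theorem exists_comp_eq_postEuler_sub_preEuler_pow {M : GradedWeylModule.{u, w} K n}
    {U V W : GradedWeylModule.{u, v} K n} {f : Hom U V} {g : Hom V W} {a b : ℕ}
    (ha : ∀ m : M, M.eulerDefect.pow a m = 0) (h' : Hom V U) (h : Hom W V)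
    (hh : ∀ x, V.eulerDefect.pow b x = f (h' x) + h (g x)) {d : ℤ} {z : M →ₗ[K] V}
    (hz : z ∈ homDeg M V d) (hgz : ∀ m, g (z m) = 0) :
    ∃ ψ ∈ homDeg M U d, f.toLinearMap.restrictScalars K ∘ₗ ψ =
      ((postEuler M V - preEuler M V) ^ (a + b)) z := by
  -- Membership in a subspace of coboundaries can be checked on each term of the binomial expansion.
  change ((postEuler M V - preEuler M V) ^ (a + b)) z ∈ (homDeg M U d).map
    (LinearMap.compRight K (M := M) (f.toLinearMap.restrictScalars K))
  have hpre : preEuler M V ^ a = 0 := LinearMap.ext fun φ => LinearMap.ext fun m => by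
    rw [preEuler_pow_apply, ha, map_zero]
    rfl
  rw [sub_eq_add_neg, (commute_postEuler_preEuler M V).neg_right.add_pow, LinearMap.sum_apply]
  refine Submodule.sum_mem _ fun i hi => ?_
  rw [Module.End.mul_apply, Module.End.natCast_apply, map_nsmul]
  refine nsmul_mem ?_ _
  suffices (postEuler M V ^ i * preEuler M V ^ (a + b - i)) z ∈ (homDeg M U d).map
      (LinearMap.compRight K (M := M) (f.toLinearMap.restrictScalars K)) by
    rw [neg_pow]
    rcases neg_one_pow_eq_or (Module.End K (M →ₗ[K] V)) (a + b - i) with h | h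
    · rwa [h, one_mul]
    · rw [h, neg_one_mul, mul_neg, LinearMap.neg_apply]
      exact neg_mem this
  -- If `i < b`, the exponent of precomposition exceeds `a` and the term vanishes. Otherwise `b`
  -- factors of postcomposition are available for the homotopy.
  rcases lt_or_ge i b with hib | hib
  · rw [show a + b - i = a + (b - i) by omega, pow_add, hpre, zero_mul, mul_zero,
      LinearMap.zero_apply]
    exact zero_mem _
  · obtain ⟨k, rfl⟩ := Nat.exists_eq_add_of_le hib
    rw [pow_add, mul_assoc, Module.End.mul_apply, Module.End.mul_apply]
    generalize a + b - (b + k) = j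
    have hw := postEuler_pow_mem M V k (preEuler_pow_mem M V j hz)
    -- The witness is `h' ∘ w`, where `w` is what the remaining factors make of `z`. The other
    -- homotopy term `h ∘ g ∘ w` is zero: `g` commutes with the Eulerian endomorphisms, so `w` is
    -- still a cocycle.
    refine ⟨_, comp_mem_homDeg M h' hw, LinearMap.ext fun m => ?_⟩
    rw [postEuler_pow_apply M V b, hh, postEuler_pow_apply M V k, Hom.map_eulerDefect_pow g,
      preEuler_pow_apply, hgz, map_zero, map_zero, add_zero]
    rw [← preEuler_pow_apply, ← postEuler_pow_apply]
    rfl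

/-- If a power of the Eulerian endomorphism of `V` is null homotopic at the middle term of
`U → V → W` and `M` is strongly generalized Eulerian, then so is the cohomology at
`*Hom_R(M, V)`. -/
theorem isStronglyGeneralizedEulerian_cohomology_starHomMap {M : GradedWeylModule.{u, w} K n}
    (hM : M.IsStronglyGeneralizedEulerian) {U V W : GradedWeylModule.{u, v} K n} {f : Hom U V}
    {g : Hom V W} {b : ℕ} (h' : Hom V U) (h : Hom W V)
    (hh : ∀ x, V.eulerDefect.pow b x = f (h' x) + h (g x)) :
    (cohomology (starHomMap M f) (starHomMap M g)).IsStronglyGeneralizedEulerian := by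
  obtain ⟨a, ha0, ha⟩ := hM
  refine ⟨a + b, by omega, ?_⟩
  -- A class of degree `d` is represented by a cocycle `z` of degree `d`; it remains to see that `(E
  -- - d)^(a+b) z` is a coboundary.
  rintro d _ ⟨⟨z, hz⟩, hzd, rfl⟩
  replace hzd : z ∈ (starHom M V).grading d := hzd
  have hgz (m : M) : g (z.1 m) = 0 := LinearMap.congr_fun (congrArg Subtype.val hz) m
  obtain ⟨ψ, hψ, hψz⟩ := exists_comp_eq_postEuler_sub_preEuler_pow
    (eulerDefect_pow_eq_zero M ha) h' h hh hzd hgz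
  refine (Submodule.Quotient.mk_eq_zero _).mpr ?_
  refine ⟨(⟨ψ, Submodule.mem_iSup_of_mem d hψ⟩ : starHomSubmodule M U), ?_⟩
  refine Eq.trans ?_ (eulerDefect_pow_of_mem (starHom M V) hzd (a + b))
  exact Subtype.ext (hψz.trans (starHom_eulerDefect_pow z hzd (a + b)).symm)

end

end GradedWeylModule

end

/-! ### The theorem on graded Ext. -/

theorem mainTheorem8 {K : Type u} [Field K] [CharZero K] {n : ℕ}
    (M : GradedWeylModule.{u, w} K n) (N : GradedWeylModule.{u, v} K n)
    (hM : M.IsStronglyGeneralizedEulerian) (hN : N.IsStronglyGeneralizedEulerian)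
    (J : GradedWeylModule.InjectiveResolution N) (i : ℕ) :
    (GradedWeylModule.starExt M J i).IsStronglyGeneralizedEulerian := by
  obtain ⟨b, -, hb⟩ := hN
  have hb := N.eulerDefect_pow_eq_zero hb
  cases i with
  | zero =>
    obtain ⟨h, hh⟩ := J.exists_homotopy_zero hb
    have := GradedWeylModule.isStronglyGeneralizedEulerian_cohomology_starHomMap hM
      (f := GradedWeylModule.Hom.zero (J.I 0) (J.I 0)) (g := J.d 0) (b := b)
      (GradedWeylModule.Hom.zero _ _) h fun x => (hh x).trans (zero_add _).symm
    -- Composition with the zero morphism is definitionally the zero morphism of `*Hom_R(M, I^0)`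
    -- that enters `starExt` in degree 0.
    exact this
  | succ k =>
    obtain ⟨h', h, hh⟩ := J.exists_homotopy_succ hb k
    exact GradedWeylModule.isStronglyGeneralizedEulerian_cohomology_starHomMap hM h' h hh
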